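/- Fix integers $1\le k\le d-1$. For $r>0$ and an integer $j\ge 0$, an $(r,j)$-plate is the open $r$-neighborhood in $\mathbb{R}^d$ of a $j$-dimensional affine plane. For $A\subset\mathbb{R}^d\times\mathbb{R}^d$ write $A|_x=\{y:(x,y)\in A\}$. For every $\kappa>0$ there exists $\eta=\eta(\kappa,k,d)>0$ such that for all $C_\mu,C_\nu$ there exists $K_0=K_0(\kappa,k,d,C_\mu,C_\nu)>0$ with the following property. Let $0<r_0\le 1$ and $K\ge K_0$. Let $\mu,\nu$ be finite positive Borel measures on $\mathbb{R}^d$ supported on sets $X,Y\subset \overline{B}(0,1)$ (that is, $\mu(\mathbb{R}^d\setminus X)=\nu(\mathbb{R}^d\setminus Y)=0$), such that for every $r>0$ and every $(r,k-1)$-plate $H$, $$\mu(H)\le C_\mu r^\kappa,\qquad \nu(H)\le C_\nu r^\kappa .$$ Let $A\subset X\times Y$ be the set of pairs $(x,y)\in X\times Y$ for which there is an $(r_0,k)$-plate $H$ with $x,y\in H$ and $\nu(H)\ge K^{-1}$. Then there exists a Borel set $B\subset\mathbb{R}^d\times\mathbb{R}^d$ with $$(\mu\times\nu)(B)\le K_0K^{-1}$$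 such that $(\mu,\nu)$ has $(\eta,Kr_0^{-\eta})$-thin $k$-plates on $(A\cup B)^c$ (complement in $\mathbb{R}^d\times\mathbb{R}^d$), i.e. for every $x\in\mathbb{R}^d$, every $r>0$ and every $(r,k)$-plate $H$ containing $x$, $$\nu\bigl(H\setminus(A|_x\cup B|_x)\bigr)\le K\left(\frac{r}{r_0}\right)^{\eta}.$$ -/

import Mathlib

open MeasureTheory

/-- An `(r, k)`-plate in `ℝ^d`: the (open) `r`-neighbourhood of a `k`-dimensional affine plane. -/
def IsPlate {d : ℕ} (r : ℝ) (k : ℕ) (H : Set (EuclideanSpace ℝ (Fin d))) : Prop :=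
  ∃ V : AffineSubspace ℝ (EuclideanSpace ℝ (Fin d)),
    (V : Set (EuclideanSpace ℝ (Fin d))).Nonempty ∧
    Module.finrank ℝ V.direction = k ∧
    H = Metric.thickening r (V : Set (EuclideanSpace ℝ (Fin d)))

/-- `μ` has `κ`-power decay, with constant `C`, on plates of dimension `k`:
`μ(H) ≤ C r^κ` for every `(r, k)`-plate `H`. -/
def HasPlateDecay {d : ℕ} (μ : Measure (EuclideanSpace ℝ (Fin d))) (k : ℕ) (κ C : ℝ) : Prop :=
  ∀ r : ℝ, 0 < r → ∀ H : Set (EuclideanSpace ℝ (Fin d)), IsPlate r k H →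
    μ H ≤ ENNReal.ofReal (C * r ^ κ)

/-- A plate `H` is `c`-concentrated on `ν` if `ν(H) ≥ c`. -/
def IsConcentrated {d : ℕ} (ν : Measure (EuclideanSpace ℝ (Fin d))) (c : ℝ)
    (H : Set (EuclideanSpace ℝ (Fin d))) : Prop :=
  ENNReal.ofReal c ≤ ν H

/-- The pairs `(x, y) ∈ X × Y` that lie in some `(r, k)`-plate that is `c`-concentrated on `ν`. -/
def concentratedPairs {d : ℕ} (ν : Measure (EuclideanSpace ℝ (Fin d)))
    (X Y : Set (EuclideanSpace ℝ (Fin d))) (c r : ℝ) (k : ℕ) :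
    Set (EuclideanSpace ℝ (Fin d) × EuclideanSpace ℝ (Fin d)) :=
  {p | p.1 ∈ X ∧ p.2 ∈ Y ∧ ∃ H : Set (EuclideanSpace ℝ (Fin d)),
    IsPlate r k H ∧ IsConcentrated ν c H ∧ p.1 ∈ H ∧ p.2 ∈ H}

/-- `(t, K)`-thin `k`-plates on `G` down from scale `r₁`: `ν(H ∩ G|ₓ) ≤ K r^t` for all
`r ∈ (0, r₁)` and all `(r, k)`-plates `H` containing `x`. Here `x` ranges over all of `ℝ^d`
(not only over the support of the first measure `μ` of the pair, which is the only role of `μ`). -/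
def HasThinPlates {d : ℕ} (ν : Measure (EuclideanSpace ℝ (Fin d))) (k : ℕ) (t K : ℝ)
    (G : Set (EuclideanSpace ℝ (Fin d) × EuclideanSpace ℝ (Fin d))) (r₁ : ℝ) : Prop :=
  ∀ x : EuclideanSpace ℝ (Fin d), ∀ r : ℝ, 0 < r → r < r₁ →
    ∀ H : Set (EuclideanSpace ℝ (Fin d)), IsPlate r k H → x ∈ H →
      ν (H ∩ {y | (x, y) ∈ G}) ≤ ENNReal.ofReal (K * r ^ t)

/-! The proof descends through scales `σ_n = relScale κ K n * r₀` with squaring thresholds `t_n =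
K⁻¹ ^ 2 ^ n`. Off an exceptional set `D n` of measure `O(t_n)`, a pair in a common
`t_{n+1}`-concentrated plate at scale `σ_{n+1}` also lies in a common `t_n`-concentrated plate at
scale `σ_n` (`exists_exceptional_set`). Iterating down to `n = 0` puts every such pair in `A` or in
the union of the `D n`, whose total measure is `O(K⁻¹)`. Given `r ≤ r₀`, choose `n` with `σ_{n+1} <
r ≤ σ_n`. If the `σ_n`-plate around the same plane is `t_n`-heavy, nothing of it survives outside `A
∪ B`; otherwise its mass is below `t_n`, which is at most a power of `σ_{n+1} / r₀`.

One step rests on geometry: neighbourhoods of two planes that are not close meet in a neighbourhood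
of a `(k - 1)`-plane (`exists_plate_of_not_affineClose`), which has small mass. Hence boundedly many
heavy planes represent all of them up to closeness, and for most `x` the representatives near `x`
are all close to one another. If one of these is light at scale `σ`, its plate contains every `y` to
be discarded. -/

/-! ### Intersections of neighbourhoods of planes. -/

/-- `V` lies within distance `r` of `W` inside the ball of radius `2`. -/
def AffineClose {d : ℕ} (r : ℝ) (V W : AffineSubspace ℝ (EuclideanSpace ℝ (Fin d))) : Prop :=
  ∀ v ∈ V, ‖v‖ ≤ 2 → v ∈ Metric.thickening r (W : Set (EuclideanSpace ℝ (Fin d)))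

/-- `V` is a nonempty affine plane of dimension `k`. -/
def IsAffinePlane {d : ℕ} (k : ℕ) (V : AffineSubspace ℝ (EuclideanSpace ℝ (Fin d))) : Prop :=
  (V : Set (EuclideanSpace ℝ (Fin d))).Nonempty ∧ Module.finrank ℝ V.direction = k

theorem IsAffinePlane.isPlate {d k : ℕ} {V : AffineSubspace ℝ (EuclideanSpace ℝ (Fin d))}
    (hV : IsAffinePlane k V) (r : ℝ) :
    IsPlate r k (Metric.thickening r (V : Set (EuclideanSpace ℝ (Fin d)))) :=
  ⟨V, hV.1, hV.2, rfl⟩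

theorem AffineClose.thickening_inter_subset {d : ℕ} {r ρ : ℝ} (hρ : ρ ≤ 1)
    {V W : AffineSubspace ℝ (EuclideanSpace ℝ (Fin d))} (h : AffineClose r V W) :
    Metric.thickening ρ (V : Set (EuclideanSpace ℝ (Fin d))) ∩ Metric.closedBall 0 1 ⊆
      Metric.thickening (ρ + r) (W : Set (EuclideanSpace ℝ (Fin d))) := by
  rintro x ⟨hx, hx1⟩
  obtain ⟨v, hv, hxv⟩ := Metric.mem_thickening_iff.1 hx
  have hv2 : ‖v‖ ≤ 2 := by
    have h1 : ‖x‖ ≤ 1 := by simpa using hx1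
    have h2 : ‖v‖ ≤ ‖x‖ + dist x v := by
      rw [dist_eq_norm']
      simpa using norm_add_le x (v - x)
    linarith
  obtain ⟨w, hw, hvw⟩ := Metric.mem_thickening_iff.1 (h v hv hv2)
  exact Metric.mem_thickening_iff.2 ⟨w, hw, by linarith [dist_triangle x v w]⟩

theorem exists_isAffinePlane_zero_mem {d j : ℕ} (hj : j ≤ d) :
    ∃ V : AffineSubspace ℝ (EuclideanSpace ℝ (Fin d)), IsAffinePlane j V ∧ 0 ∈ V := by
  let b := EuclideanSpace.basisFun (Fin d) ℝ
  have hb : LinearIndependent ℝ (b ∘ Fin.castLE hj) :=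
    b.orthonormal.linearIndependent.comp _ (Fin.castLE_injective hj)
  refine ⟨AffineSubspace.mk' 0 (Submodule.span ℝ (Set.range (b ∘ Fin.castLE hj))),
    ⟨⟨0, AffineSubspace.self_mem_mk' _ _⟩, ?_⟩, AffineSubspace.self_mem_mk' _ _⟩
  rw [AffineSubspace.direction_mk', finrank_span_eq_card hb, Fintype.card_fin]

/-- Thin neighbourhoods of two `k`-planes that are not close meet in a thin neighbourhood of a
`(k - 1)`-plane. -/
theorem exists_plate_of_not_affineClose {d k : ℕ} (hkd : k ≤ d) {r ρ : ℝ}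
    (hρ : 0 < ρ) (hr : r ≤ 1) (hρr : 4 * ρ ≤ r)
    {V W : AffineSubspace ℝ (EuclideanSpace ℝ (Fin d))} (hV : IsAffinePlane k V)
    (hW : (W : Set (EuclideanSpace ℝ (Fin d))).Nonempty) (hVW : ¬ AffineClose r V W) :
    ∃ H, IsPlate (18 * ρ / r) (k - 1) H ∧
      Metric.thickening ρ (V : Set (EuclideanSpace ℝ (Fin d))) ∩
        Metric.thickening ρ (W : Set (EuclideanSpace ℝ (Fin d))) ∩ Metric.closedBall 0 1 ⊆ H := by
  simp only [AffineClose, not_forall] at hVW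
  obtain ⟨v, hv, hv2, hvW⟩ := hVW
  obtain ⟨p, hp⟩ := hW
  have hr0 : 0 < r := by linarith
  -- `w₀` is the foot of the perpendicular from `v` to `W`, so `u = v - w₀` is normal to `W` and has
  -- length at least `r`.
  set w₀ := p + W.direction.starProjection (v - p) with hw₀
  have hw₀W : w₀ ∈ W := by
    rw [hw₀, add_comm]
    exact AffineSubspace.vadd_mem_of_mem_direction
      (Submodule.starProjection_apply_mem _ _) hp
  set u := v - w₀ with hu
  have huW : ∀ w ∈ W.direction, inner ℝ u w = 0 := by
    intro w hw
    have : u = (v - p) - W.direction.starProjection (v - p) := by rw [hu, hw₀]; abel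
    rw [this]
    exact Submodule.starProjection_inner_eq_zero _ _ hw
  have hur : r ≤ ‖u‖ := by
    by_contra hlt
    exact hvW (Metric.mem_thickening_iff.2 ⟨w₀, hw₀W, by rw [dist_eq_norm]; linarith⟩)
  set g := V.direction.starProjection u with hg
  have hgV : g ∈ V.direction := Submodule.starProjection_apply_mem _ _
  have hug : ∀ w ∈ V.direction, inner ℝ u w = inner ℝ g w := by
    intro w hw
    have := Submodule.starProjection_inner_eq_zero (K := V.direction) u w hw
    rw [inner_sub_left] at this
    linarith
  -- Pairing with `u` kills `W`, so nearness to both planes forces `x'` to nearly solve one affine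
  -- equation on `V`, with gradient `g`.
  have key : ∀ x ∈ Metric.thickening ρ (V : Set (EuclideanSpace ℝ (Fin d))) ∩
      Metric.thickening ρ (W : Set (EuclideanSpace ℝ (Fin d))) ∩ Metric.closedBall 0 1,
      ∃ x' ∈ V, dist x x' < ρ ∧ ‖x' - v‖ ≤ 4 ∧
        |‖u‖ ^ 2 + inner ℝ g (x' - v)| ≤ 2 * ρ * ‖u‖ := by
    rintro x ⟨⟨hxV, hxW⟩, hx1⟩
    obtain ⟨x', hx'V, hxx'⟩ := Metric.mem_thickening_iff.1 hxV
    obtain ⟨w, hwW, hxw⟩ := Metric.mem_thickening_iff.1 hxW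
    refine ⟨x', hx'V, hxx', ?_, ?_⟩
    · have h1 : ‖x‖ ≤ 1 := by simpa using hx1
      have h2 : ‖x' - v‖ ≤ dist x x' + ‖x‖ + ‖v‖ := by
        rw [dist_eq_norm']
        calc ‖x' - v‖ = ‖(x' - x) + x - v‖ := by congr 1; abel
          _ ≤ ‖(x' - x) + x‖ + ‖v‖ := norm_sub_le _ _
          _ ≤ _ := by gcongr; exact norm_add_le _ _
      linarith
    · have e1 : inner ℝ g (x' - v) = inner ℝ u (x' - v) :=
        (hug _ (AffineSubspace.vsub_mem_direction hx'V hv)).symm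
      have e2 : inner ℝ u (w - w₀) = 0 := huW _ (AffineSubspace.vsub_mem_direction hwW hw₀W)
      have e3 : ‖u‖ ^ 2 + inner ℝ g (x' - v) = inner ℝ u (x' - w) := by
        rw [e1, ← real_inner_self_eq_norm_sq, ← inner_add_right]
        have : x' - w = (u + (x' - v)) - (w - w₀) := by rw [hu]; abel
        rw [this, inner_sub_right, e2, sub_zero]
      rw [e3]
      calc |inner ℝ u (x' - w)| ≤ ‖u‖ * ‖x' - w‖ := abs_real_inner_le_norm _ _
        _ ≤ ‖u‖ * (2 * ρ) := by
            gcongr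
            rw [← dist_eq_norm]
            linarith [dist_triangle_left x' w x]
        _ = _ := by ring
  -- If `g = 0`, the estimate would give `‖u‖ ≤ 2 * ρ < r`: the intersection is empty and any plate
  -- serves.
  by_cases hg0 : g = 0
  · obtain ⟨U, hU, -⟩ := exists_isAffinePlane_zero_mem (d := d) (j := k - 1) (by omega)
    refine ⟨_, hU.isPlate _, fun x hx => ?_⟩
    obtain ⟨x', -, -, -, h⟩ := key x hx
    rw [hg0, inner_zero_left, add_zero, abs_of_nonneg (by positivity)] at h
    nlinarith
  · have hgpos : 0 < ‖g‖ := norm_pos_iff.2 hg0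
    let z := v - (‖u‖ ^ 2 / ‖g‖ ^ 2) • g
    let U := AffineSubspace.mk' z ((ℝ ∙ g)ᗮ ⊓ V.direction)
    have hU : IsAffinePlane (k - 1) U := by
      refine ⟨⟨z, AffineSubspace.self_mem_mk' _ _⟩, ?_⟩
      rw [AffineSubspace.direction_mk']
      refine Submodule.finrank_add_inf_finrank_orthogonal' (K₁ := ℝ ∙ g) (by simpa using hgV) ?_
      rw [finrank_span_singleton hg0, hV.2]
      have : 0 < k := by
        rw [← hV.2]
        exact Module.finrank_pos_iff_exists_ne_zero.2 ⟨⟨g, hgV⟩, by simpa using hg0⟩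
      omega
    refine ⟨_, hU.isPlate _, fun x hx => ?_⟩
    obtain ⟨x', hx'V, hxx', h4, h⟩ := key x hx
    set a := ‖u‖ ^ 2 + inner ℝ g (x' - v) with ha
    -- A point of the intersection bounds the slope from below: `‖u‖ ^ 2 ≤ 4 * ‖g‖ + 2 * ρ * ‖u‖`,
    -- and the last term is at most half the left side.
    have hgu : ‖u‖ ^ 2 ≤ 8 * ‖g‖ := by
      have h1 : |inner ℝ g (x' - v)| ≤ ‖g‖ * 4 :=
        (abs_real_inner_le_norm _ _).trans (by gcongr)
      have h2 := (abs_le.1 h1).1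
      have h3 := (abs_le.1 h).2
      nlinarith
    refine Metric.mem_thickening_iff.2 ⟨x' - (a / ‖g‖ ^ 2) • g, ?_, ?_⟩
    · change _ ∈ U
      rw [AffineSubspace.mem_mk']
      refine ⟨?_, ?_⟩
      · rw [SetLike.mem_coe, Submodule.mem_orthogonal_singleton_iff_inner_right]
        have : x' - (a / ‖g‖ ^ 2) • g -ᵥ z
            = (x' - v) - ((inner ℝ g (x' - v)) / ‖g‖ ^ 2) • g := by
          simp only [z, ha, vsub_eq_sub, add_div, add_smul]
          abel
        rw [this, inner_sub_right, inner_smul_right, real_inner_self_eq_norm_sq]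
        field_simp
        ring
      · have : x' - (a / ‖g‖ ^ 2) • g -ᵥ z
            = (x' -ᵥ v) + (‖u‖ ^ 2 / ‖g‖ ^ 2) • g - (a / ‖g‖ ^ 2) • g := by
          simp only [z, vsub_eq_sub]
          abel
        rw [this]
        exact Submodule.sub_mem _ (Submodule.add_mem _ (AffineSubspace.vsub_mem_direction hx'V hv)
          (Submodule.smul_mem _ _ hgV)) (Submodule.smul_mem _ _ hgV)
    · have h5 : dist x' (x' - (a / ‖g‖ ^ 2) • g) = |a| / ‖g‖ := by
        rw [dist_eq_norm, sub_sub_cancel, norm_smul, Real.norm_eq_abs, abs_div,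
          abs_of_nonneg (by positivity : (0 : ℝ) ≤ ‖g‖ ^ 2)]
        field_simp
      have h6 : |a| / ‖g‖ ≤ 16 * ρ / r := by
        rw [div_le_div_iff₀ hgpos hr0]
        have hup : 0 < ‖u‖ := by linarith
        calc |a| * r ≤ (2 * ρ * ‖u‖) * ‖u‖ := by gcongr
          _ = 2 * ρ * ‖u‖ ^ 2 := by ring
          _ ≤ 2 * ρ * (8 * ‖g‖) := by gcongr
          _ = _ := by ring
      have h7 : ρ ≤ 2 * ρ / r := by
        rw [le_div_iff₀ hr0]
        nlinarith
      have h8 : 18 * ρ / r = 2 * ρ / r + 16 * ρ / r := by ring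
      linarith [dist_triangle x x' (x' - (a / ‖g‖ ^ 2) • g)]

/-! ### Finite families with small overlaps. -/

/-- If chains for a relation have bounded length, a finite list dominates every element. -/
theorem exists_list_forall_exists_of_length_lt {α : Type*} {S : Set α} {R : α → α → Prop} {L : ℕ}
    (h : ∀ l : List α, (∀ a ∈ l, a ∈ S) → l.Pairwise (fun a b => ¬ R a b) → l.length < L) :
    ∃ l : List α, (∀ a ∈ l, a ∈ S) ∧ l.length < L ∧ ∀ a ∈ S, ∃ b ∈ l, R a b := by
  by_contra hcon
  have : ∀ n, ∃ l : List α, (∀ a ∈ l, a ∈ S) ∧ l.Pairwise (fun a b => ¬ R a b) ∧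
      l.length = n := by
    intro n
    induction n with
    | zero => exact ⟨[], by simp⟩
    | succ n ih =>
      obtain ⟨l, h1, h2, h3⟩ := ih
      have : ∃ a ∈ S, ∀ b ∈ l, ¬ R a b := by
        by_contra h4
        push Not at h4
        exact hcon ⟨l, h1, h l h1 h2, h4⟩
      obtain ⟨a, ha, hab⟩ := this
      -- Prepending matches the order in `Pairwise`, so `R` need not be symmetric.
      exact ⟨a :: l, by simpa using ⟨ha, h1⟩, List.pairwise_cons.2 ⟨hab, h2⟩, by simp [h3]⟩
  obtain ⟨l, h1, h2, h3⟩ := this L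
  exact absurd (h l h1 h2) (by omega)

theorem measureReal_inter_iUnion_list_le {Ω α : Type*} [MeasurableSpace Ω] (ν : Measure Ω)
    [IsFiniteMeasure ν] (E : α → Set Ω) (A : Set Ω) {δ : ℝ} (l : List α)
    (h : ∀ a ∈ l, ν.real (A ∩ E a) ≤ δ) :
    ν.real (A ∩ ⋃ a ∈ l, E a) ≤ l.length * δ := by
  induction l with
  | nil => simp
  | cons a l ih =>
    have h1 := h a (by simp)
    have h2 := ih fun b hb => h b (by simp [hb])
    have : A ∩ ⋃ b ∈ a :: l, E b = (A ∩ E a) ∪ (A ∩ ⋃ b ∈ l, E b) := by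
      ext; simp; tauto
    rw [this]
    refine (measureReal_union_le _ _).trans ?_
    push_cast [List.length_cons]
    linarith

/-- A Bonferroni inequality for a list of sets with small pairwise intersections. -/
theorem length_mul_le_measureReal_iUnion {Ω α : Type*} [MeasurableSpace Ω] (ν : Measure Ω)
    [IsFiniteMeasure ν] (E : α → Set Ω) (hE : ∀ a, MeasurableSet (E a)) {t δ : ℝ} (hδ : 0 ≤ δ)
    (l : List α) (ht : ∀ a ∈ l, t ≤ ν.real (E a))
    (h : l.Pairwise (fun a b => ν.real (E a ∩ E b) ≤ δ)) :
    l.length * t ≤ ν.real (⋃ a ∈ l, E a) + (l.length : ℝ) ^ 2 * δ := by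
  induction l with
  | nil => simp
  | cons a l ih =>
    rw [List.pairwise_cons] at h
    have h1 := ht a (by simp)
    have h2 := ih (fun b hb => ht b (by simp [hb])) h.2
    have h3 := measureReal_inter_iUnion_list_le ν E (E a) l h.1
    have h4 : ⋃ b ∈ a :: l, E b = E a ∪ ⋃ b ∈ l, E b := by
      ext; simp
    have hm : MeasurableSet (⋃ b ∈ l, E b) :=
      MeasurableSet.biUnion (List.finite_toSet l).countable fun b _ => hE b
    have h5 := measureReal_union_add_inter (μ := ν) (s := E a) hm
      (measure_ne_top _ _) (measure_ne_top _ _)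
    rw [h4]
    push_cast [List.length_cons]
    nlinarith [Nat.cast_nonneg (α := ℝ) l.length]

theorem length_lt_of_pairwise_measureReal_inter_le {Ω α : Type*} [MeasurableSpace Ω]
    (ν : Measure Ω) [IsFiniteMeasure ν] (E : α → Set Ω) (hE : ∀ a, MeasurableSet (E a))
    {t δ m : ℝ} (hδ : 0 ≤ δ) (hm : ν.real Set.univ ≤ m) {L : ℕ}
    (hL : m + (L : ℝ) ^ 2 * δ < L * t)
    (l : List α) (ht : ∀ a ∈ l, t ≤ ν.real (E a))
    (h : l.Pairwise (fun a b => ν.real (E a ∩ E b) ≤ δ)) : l.length < L := by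
  by_contra hlen
  -- The Bonferroni error is quadratic in the length, so the list is cut to exactly `L` elements.
  have hlen : (l.take L).length = L := by simpa using hlen
  have h1 := length_mul_le_measureReal_iUnion ν E hE hδ (l.take L)
    (fun a ha => ht a (List.mem_of_mem_take ha)) (h.sublist (List.take_sublist _ _))
  have h2 : ν.real (⋃ a ∈ l.take L, E a) ≤ ν.real Set.univ := measureReal_mono (Set.subset_univ _)
  rw [hlen] at h1
  linarith

/-! ### Passage between two consecutive scales. -/

theorem HasPlateDecay.measureReal_inter_le {d k : ℕ} (hkd : k ≤ d) {κ C r ρ : ℝ}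
    (hC : 0 ≤ C) (hρ : 0 < ρ) (hr : r ≤ 1) (hρr : 4 * ρ ≤ r)
    {μ : Measure (EuclideanSpace ℝ (Fin d))} (hμ : HasPlateDecay μ (k - 1) κ C)
    {V W : AffineSubspace ℝ (EuclideanSpace ℝ (Fin d))} (hV : IsAffinePlane k V)
    (hW : IsAffinePlane k W) (hVW : ¬ AffineClose r V W) :
    μ.real ((Metric.thickening ρ (V : Set (EuclideanSpace ℝ (Fin d))) ∩ Metric.closedBall 0 1) ∩
      (Metric.thickening ρ (W : Set (EuclideanSpace ℝ (Fin d))) ∩ Metric.closedBall 0 1)) ≤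
      C * (18 * ρ / r) ^ κ := by
  obtain ⟨H, hH, hsub⟩ := exists_plate_of_not_affineClose hkd hρ hr hρr hV hW.1 hVW
  have hr0 : 0 < r := by linarith
  refine ENNReal.toReal_le_of_le_ofReal (by positivity) ((measure_mono ?_).trans
    (hμ _ (by positivity) H hH))
  exact fun x hx => hsub ⟨⟨hx.1.1, hx.2.1⟩, hx.1.2⟩

/-- Passing from scale `σ` to the scale `σ * q ^ 2`: outside a small set, pairs lying in a common
`t ^ 2`-concentrated plate at the small scale lie in a common `t`-concentrated plate at the large
scale. -/
theorem exists_exceptional_set {d k : ℕ} (hkd : k ≤ d) {κ C m t σ q : ℝ} (hκ : 0 < κ)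
    (hC : 0 ≤ C) (hm : 1 ≤ m) (ht : 0 < t) (ht1 : t ≤ 1) (hσ : 0 < σ) (hσ1 : σ ≤ 1)
    (hq : 0 < q) (hq16 : q ≤ 1 / 16) (hsmall : 9 * m ^ 3 * (C * (72 * q) ^ κ) ≤ t ^ 5)
    (μ ν : Measure (EuclideanSpace ℝ (Fin d))) [IsFiniteMeasure μ] [IsFiniteMeasure ν]
    (hμm : μ.real Set.univ ≤ m) (hνm : ν.real Set.univ ≤ m)
    (hνB : ν (Metric.closedBall 0 1)ᶜ = 0)
    (hμ : HasPlateDecay μ (k - 1) κ C) (hν : HasPlateDecay ν (k - 1) κ C) :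
    ∃ D : Set (EuclideanSpace ℝ (Fin d) × EuclideanSpace ℝ (Fin d)), MeasurableSet D ∧
      (μ.prod ν) D ≤ ENNReal.ofReal ((1 + m) * t) ∧
      ∀ V : AffineSubspace ℝ (EuclideanSpace ℝ (Fin d)), IsAffinePlane k V →
        ENNReal.ofReal (t ^ 2) ≤
          ν (Metric.thickening (σ * q ^ 2) (V : Set (EuclideanSpace ℝ (Fin d)))) →
        ∀ x ∈ Metric.closedBall 0 1, ∀ y ∈ Metric.closedBall 0 1,
          x ∈ Metric.thickening (σ * q ^ 2) (V : Set (EuclideanSpace ℝ (Fin d))) →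
          y ∈ Metric.thickening (σ * q ^ 2) (V : Set (EuclideanSpace ℝ (Fin d))) →
          (x, y) ∈ D ∨ ∃ W : AffineSubspace ℝ (EuclideanSpace ℝ (Fin d)),
            IsAffinePlane k W ∧
            x ∈ Metric.thickening σ (W : Set (EuclideanSpace ℝ (Fin d))) ∧
            y ∈ Metric.thickening σ (W : Set (EuclideanSpace ℝ (Fin d))) ∧
            ENNReal.ofReal t ≤ ν (Metric.thickening σ (W : Set (EuclideanSpace ℝ (Fin d)))) := by
  let S : Set (AffineSubspace ℝ (EuclideanSpace ℝ (Fin d))) :=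
    {V | IsAffinePlane k V ∧ ENNReal.ofReal (t ^ 2) ≤
      ν (Metric.thickening (σ * q ^ 2) (V : Set (EuclideanSpace ℝ (Fin d))))}
  let T (ρ : ℝ) (V : AffineSubspace ℝ (EuclideanSpace ℝ (Fin d))) :
    Set (EuclideanSpace ℝ (Fin d)) :=
    Metric.thickening ρ (V : Set (EuclideanSpace ℝ (Fin d))) ∩ Metric.closedBall 0 1
  have hT : ∀ ρ V, MeasurableSet (T ρ V) := fun ρ V =>
    Metric.isOpen_thickening.measurableSet.inter Metric.isClosed_closedBall.measurableSet
  have hq2 : q ^ 2 ≤ q / 16 := by nlinarith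
  have hσq : σ * q ≤ 1 / 16 := by nlinarith
  have hσq' : σ * q ≤ σ / 16 := by nlinarith
  have hσq2 : σ * q ^ 2 ≤ σ * q / 16 := by
    calc σ * q ^ 2 ≤ σ * (q / 16) := by gcongr
      _ = _ := by ring
  have hσqpos : 0 < σ * q := by positivity
  -- `72 * q` is `18 * (2 * σ * q) / (σ / 2)`, the plate radius needed for `E`; the list `l` needs
  -- only `18 * q`.
  set δ := C * (72 * q) ^ κ with hδdef
  have hδ : 0 ≤ δ := by positivity
  set L := ⌊2 * m / t ^ 2⌋₊ + 1 with hLdef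
  have ht21 : t ^ 2 ≤ 1 := pow_le_one₀ ht.le ht1
  have hL1 : 2 * m < L * t ^ 2 := by
    have := Nat.lt_floor_add_one (2 * m / t ^ 2)
    rw [div_lt_iff₀ (by positivity)] at this
    rw [hLdef]
    push_cast
    linarith
  have hL2 : L * t ^ 2 ≤ 3 * m := by
    have := Nat.floor_le (a := 2 * m / t ^ 2) (by positivity)
    rw [le_div_iff₀ (by positivity)] at this
    rw [hLdef]
    push_cast
    linarith
  have hLδ : (L : ℝ) ^ 2 * δ * m ≤ t := by
    have h1 : ((L : ℝ) * t ^ 2) ^ 2 ≤ (3 * m) ^ 2 := by gcongr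
    have h2 : (L : ℝ) ^ 2 * δ * m * t ^ 4 ≤ t * t ^ 4 := by
      calc (L : ℝ) ^ 2 * δ * m * t ^ 4 = (L * t ^ 2) ^ 2 * (δ * m) := by ring
        _ ≤ (3 * m) ^ 2 * (δ * m) := by gcongr
        _ = 9 * m ^ 3 * δ := by ring
        _ ≤ t ^ 5 := hsmall
        _ = t * t ^ 4 := by ring
    exact le_of_mul_le_mul_right h2 (by positivity)
  have hLδ1 : (L : ℝ) ^ 2 * δ ≤ 1 := by
    have : (L : ℝ) ^ 2 * δ * 1 ≤ (L : ℝ) ^ 2 * δ * m := by gcongr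
    linarith
  obtain ⟨l, hlS, hlL, hl⟩ := exists_list_forall_exists_of_length_lt (S := S)
    (R := AffineClose (σ * q)) (L := L) (by
      intro l hlS hl
      refine length_lt_of_pairwise_measureReal_inter_le ν (T (σ * q ^ 2)) (hT _) hδ hνm
        (t := t ^ 2) (by linarith) l ?_ ?_
      · intro V hV
        have h1 := (hlS V hV).2
        have h2 : ν (T (σ * q ^ 2) V) =
            ν (Metric.thickening (σ * q ^ 2) (V : Set (EuclideanSpace ℝ (Fin d)))) :=
          measure_inter_conull hνB
        rw [← h2] at h1
        exact (ENNReal.ofReal_le_iff_le_toReal (measure_ne_top _ _)).1 h1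
      · refine hl.imp_of_mem fun {V W} hV hW hVW => ?_
        refine (hν.measureReal_inter_le hkd hC (by positivity) (by linarith) (by linarith)
          (hlS V hV).1 (hlS W hW).1 hVW).trans ?_
        rw [hδdef]
        have : 18 * (σ * q ^ 2) / (σ * q) ≤ 72 * q := by
          rw [div_le_iff₀ hσqpos]
          nlinarith [mul_pos hσqpos hq]
        gcongr)
  -- `E` collects the points near two representatives that are not `σ / 2`-close.
  let F (V W : AffineSubspace ℝ (EuclideanSpace ℝ (Fin d))) : Set (EuclideanSpace ℝ (Fin d)) :=
    ⋃ _ : ¬ AffineClose (σ / 2) V W, T (2 * (σ * q)) V ∩ T (2 * (σ * q)) W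
  let E : Set (EuclideanSpace ℝ (Fin d)) := ⋃ V ∈ l, ⋃ W ∈ l, F V W
  have hlc : {V | V ∈ l}.Countable := (List.finite_toSet l).countable
  have hE : MeasurableSet E :=
    MeasurableSet.biUnion hlc fun V _ => MeasurableSet.biUnion hlc fun W _ =>
      MeasurableSet.iUnion fun _ => (hT _ _).inter (hT _ _)
  have hF : ∀ V ∈ l, ∀ W ∈ l, μ.real (F V W) ≤ δ := by
    intro V hV W hW
    by_cases h : AffineClose (σ / 2) V W
    · simpa [F, h] using hδ
    · simp only [F, h, not_false_eq_true, Set.iUnion_true]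
      refine (hμ.measureReal_inter_le hkd hC (by positivity) (by linarith) (by linarith)
          (hlS V hV).1 (hlS W hW).1 h).trans_eq ?_
      rw [hδdef]
      congr 2
      field_simp
      norm_num
  have hμE : μ.real E ≤ (L : ℝ) ^ 2 * δ := by
    have h1 : ∀ V ∈ l, μ.real (⋃ W ∈ l, F V W) ≤ l.length * δ := by
      intro V hV
      have := measureReal_inter_iUnion_list_le μ (F V) Set.univ (δ := δ) l
        (by simpa using hF V hV)
      simpa using this
    have h2 := measureReal_inter_iUnion_list_le μ (fun V => ⋃ W ∈ l, F V W) Set.univ l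
      (by simpa using h1)
    rw [Set.univ_inter] at h2
    have hlen : (l.length : ℝ) ≤ L := by exact_mod_cast hlL.le
    calc μ.real E ≤ l.length * (l.length * δ) := h2
      _ ≤ L * (L * δ) := by gcongr
      _ = _ := by ring
  let G : Set (EuclideanSpace ℝ (Fin d) × EuclideanSpace ℝ (Fin d)) :=
    ⋃ V ∈ l, ⋃ _ : ν (Metric.thickening σ (V : Set (EuclideanSpace ℝ (Fin d)))) < ENNReal.ofReal t,
      T (2 * (σ * q)) V ×ˢ T (2 * (σ * q)) V
  have hG : MeasurableSet G :=
    MeasurableSet.biUnion hlc fun V _ => MeasurableSet.iUnion fun _ => (hT _ _).prod (hT _ _)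
  have hD : MeasurableSet (E ×ˢ Set.univ ∪ G) := (hE.prod MeasurableSet.univ).union hG
  refine ⟨E ×ˢ Set.univ ∪ G, hD, ?_, ?_⟩
  · have hslice : ∀ x, ν (Prod.mk x ⁻¹' (E ×ˢ Set.univ ∪ G)) ≤
        E.indicator (fun _ => ν Set.univ) x + ENNReal.ofReal t := by
      intro x
      by_cases hx : x ∈ E
      · rw [Set.indicator_of_mem hx]
        exact (measure_mono (Set.subset_univ _)).trans le_self_add
      · refine le_trans ?_ le_add_self
        by_cases hne : ∃ V ∈ l,
            ν (Metric.thickening σ (V : Set (EuclideanSpace ℝ (Fin d)))) < ENNReal.ofReal t ∧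
            x ∈ T (2 * (σ * q)) V
        · obtain ⟨V, hV, hVt, hxV⟩ := hne
          refine (measure_mono ?_).trans hVt.le
          rintro y (hy | hy)
          · exact absurd hy.1 hx
          · simp only [G, Set.mem_iUnion] at hy
            obtain ⟨W, hW, -, hxW, hyW⟩ := hy
            -- Since `x ∉ E`, every `W` contributing to the slice is close to the one light `V`, and
            -- `2 * σ * q + σ / 2 ≤ σ` puts the slice in the light plate of `V`.
            have hWV : AffineClose (σ / 2) W V := by
              by_contra hWV
              exact hx (Set.mem_biUnion hW (Set.mem_biUnion hV
                (Set.mem_iUnion.2 ⟨hWV, hxW, hxV⟩)))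
            exact Metric.thickening_mono (by linarith) _
              (hWV.thickening_inter_subset (by linarith) hyW)
        · have : Prod.mk x ⁻¹' (E ×ˢ Set.univ ∪ G) = ∅ := by
            rw [Set.eq_empty_iff_forall_notMem]
            rintro y (hy | hy)
            · exact hx hy.1
            · simp only [G, Set.mem_iUnion] at hy
              obtain ⟨W, hW, hWt, hxW, -⟩ := hy
              exact hne ⟨W, hW, hWt, hxW⟩
          simp [this]
    rw [Measure.prod_apply hD]
    refine (lintegral_mono hslice).trans ?_
    rw [lintegral_add_right _ measurable_const, lintegral_indicator_const hE, lintegral_const]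
    have e1 : ν Set.univ ≤ ENNReal.ofReal m :=
      (ENNReal.le_ofReal_iff_toReal_le (measure_ne_top _ _) (by linarith)).2 hνm
    have e2 : μ Set.univ ≤ ENNReal.ofReal m :=
      (ENNReal.le_ofReal_iff_toReal_le (measure_ne_top _ _) (by linarith)).2 hμm
    have e3 : μ E ≤ ENNReal.ofReal ((L : ℝ) ^ 2 * δ) :=
      (ENNReal.le_ofReal_iff_toReal_le (measure_ne_top _ _) (by positivity)).2 hμE
    calc ν Set.univ * μ E + ENNReal.ofReal t * μ Set.univ
        ≤ ENNReal.ofReal m * ENNReal.ofReal ((L : ℝ) ^ 2 * δ)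
          + ENNReal.ofReal t * ENNReal.ofReal m := by gcongr
      _ = ENNReal.ofReal (m * ((L : ℝ) ^ 2 * δ) + t * m) := by
          rw [← ENNReal.ofReal_mul (by linarith), ← ENNReal.ofReal_mul ht.le,
            ENNReal.ofReal_add (by positivity) (by positivity)]
      _ ≤ _ := ENNReal.ofReal_le_ofReal (by linarith)
  · intro V hV hVt x hx y hy hxV hyV
    obtain ⟨W, hW, hVW⟩ := hl V ⟨hV, hVt⟩
    have hsub := hVW.thickening_inter_subset (ρ := σ * q ^ 2) (by linarith)
    have hle : Metric.thickening (σ * q ^ 2 + σ * q) (W : Set (EuclideanSpace ℝ (Fin d))) ⊆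
        Metric.thickening (2 * (σ * q)) (W : Set (EuclideanSpace ℝ (Fin d))) :=
      Metric.thickening_mono (by linarith) _
    have hxW := hle (hsub ⟨hxV, hx⟩)
    have hyW := hle (hsub ⟨hyV, hy⟩)
    by_cases hWt : ν (Metric.thickening σ (W : Set (EuclideanSpace ℝ (Fin d)))) < ENNReal.ofReal t
    · exact Or.inl (Or.inr (Set.mem_biUnion hW (Set.mem_iUnion.2 ⟨hWt, ⟨hxW, hx⟩, ⟨hyW, hy⟩⟩)))
    · exact Or.inr ⟨W, (hlS W hW).1, Metric.thickening_mono (by linarith) _ hxW,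
        Metric.thickening_mono (by linarith) _ hyW, not_lt.1 hWt⟩

/-! ### Thresholds and scales. -/

/-- The concentration threshold at the `n`-th scale. -/
noncomputable def concThreshold (K : ℝ) (n : ℕ) : ℝ := K⁻¹ ^ 2 ^ n

/-- The square root of the ratio between the scales `n + 1` and `n`. -/
noncomputable def scaleRatio (κ K : ℝ) (n : ℕ) : ℝ := concThreshold K n ^ (6 / κ)

/-- The `n`-th scale, relative to the initial one. -/
noncomputable def relScale (κ K : ℝ) (n : ℕ) : ℝ := ∏ i ∈ Finset.range n, scaleRatio κ K i ^ 2

theorem concThreshold_pos {K : ℝ} (hK : 0 < K) (n : ℕ) : 0 < concThreshold K n := by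
  unfold concThreshold; positivity

theorem concThreshold_le {K : ℝ} (hK : 1 ≤ K) (n : ℕ) : concThreshold K n ≤ K⁻¹ :=
  pow_le_of_le_one (by positivity) (inv_le_one_of_one_le₀ hK) (by positivity)

theorem concThreshold_succ (K : ℝ) (n : ℕ) : concThreshold K (n + 1) = concThreshold K n ^ 2 := by
  rw [concThreshold, concThreshold, ← pow_mul, pow_succ]

theorem concThreshold_le_geometric {K : ℝ} (hK : 2 ≤ K) (n : ℕ) :
    concThreshold K n ≤ K⁻¹ * (1 / 2) ^ n := by
  induction n with
  | zero => simp [concThreshold]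
  | succ n ih =>
    have h1 := concThreshold_le (by linarith : 1 ≤ K) n
    have h2 : K⁻¹ ≤ 1 / 2 := by rw [one_div]; gcongr
    have h3 := concThreshold_pos (by linarith : 0 < K) n
    rw [concThreshold_succ, pow_succ (1 / 2 : ℝ), ← mul_assoc, sq]
    gcongr
    linarith

theorem scaleRatio_pos {κ K : ℝ} (hK : 0 < K) (n : ℕ) : 0 < scaleRatio κ K n :=
  Real.rpow_pos_of_pos (concThreshold_pos hK n) _

theorem scaleRatio_succ {κ K : ℝ} (hK : 0 < K) (n : ℕ) :
    scaleRatio κ K (n + 1) = scaleRatio κ K n ^ 2 := by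
  rw [scaleRatio, scaleRatio, concThreshold_succ, sq, sq,
    Real.mul_rpow (concThreshold_pos hK n).le (concThreshold_pos hK n).le]

/-- Of the six powers, five supply the `t ^ 5` in `exists_exceptional_set` and the sixth absorbs the
constant `K₀`. -/
theorem scaleRatio_rpow {κ K : ℝ} (hκ : 0 < κ) (hK : 0 < K) (n : ℕ) :
    scaleRatio κ K n ^ κ = concThreshold K n ^ 6 := by
  rw [scaleRatio, ← Real.rpow_mul (concThreshold_pos hK n).le, div_mul_cancel₀ _ hκ.ne']
  exact Real.rpow_natCast _ 6

theorem scaleRatio_le {κ K : ℝ} (hκ : 0 < κ) (hK1 : 1 ≤ K) (hK : 72 ^ κ ≤ K) (n : ℕ) :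
    scaleRatio κ K n ≤ 1 / 16 := by
  have hK0 : 0 < K := by linarith
  have hq := scaleRatio_pos (κ := κ) hK0 n
  have ht := concThreshold_pos hK0 n
  have ht1 := concThreshold_le hK1 n
  have h1 : (72 * scaleRatio κ K n) ^ κ ≤ 1 := by
    rw [Real.mul_rpow (by norm_num) hq.le, scaleRatio_rpow hκ hK0]
    calc 72 ^ κ * concThreshold K n ^ 6 ≤ K * K⁻¹ := by
          gcongr
          exact (pow_le_of_le_one ht.le (ht1.trans (inv_le_one_of_one_le₀ hK1))
            (by norm_num)).trans ht1
      _ = 1 := mul_inv_cancel₀ hK0.ne'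
  have h2 : 72 * scaleRatio κ K n ≤ 1 := by
    by_contra h
    exact absurd (Real.one_lt_rpow (not_le.1 h) hκ) (not_lt.2 h1)
  linarith

theorem relScale_succ (κ K : ℝ) (n : ℕ) :
    relScale κ K (n + 1) = relScale κ K n * scaleRatio κ K n ^ 2 :=
  Finset.prod_range_succ _ _

theorem relScale_pos {κ K : ℝ} (hK : 0 < K) (n : ℕ) : 0 < relScale κ K n :=
  Finset.prod_pos fun i _ => pow_pos (scaleRatio_pos hK i) 2

theorem relScale_le_pow {κ K : ℝ} (hκ : 0 < κ) (hK1 : 1 ≤ K) (hK : 72 ^ κ ≤ K) (n : ℕ) :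
    relScale κ K n ≤ (1 / 2) ^ n := by
  induction n with
  | zero => simp [relScale]
  | succ n ih =>
    have h1 := scaleRatio_le hκ hK1 hK n
    have h2 := scaleRatio_pos (κ := κ) (by linarith : 0 < K) n
    rw [relScale_succ, pow_succ (1 / 2 : ℝ)]
    gcongr
    nlinarith

/-- The ratios square at each step, so the product of all earlier ones is no smaller than the
current one. -/
theorem scaleRatio_pow_le_relScale {κ K : ℝ} (hκ : 0 < κ) (hK1 : 1 ≤ K) (hK : 72 ^ κ ≤ K)
    (n : ℕ) : scaleRatio κ K n ^ 4 ≤ relScale κ K (n + 1) := by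
  have hK0 : 0 < K := by linarith
  rw [relScale_succ]
  have e : scaleRatio κ K n ^ 4 = scaleRatio κ K n ^ 2 * scaleRatio κ K n ^ 2 := by ring
  rw [e]
  clear e
  gcongr
  induction n with
  | zero =>
    have h1 := scaleRatio_le hκ hK1 hK 0
    have h2 := scaleRatio_pos (κ := κ) hK0 0
    simp only [relScale, Finset.range_zero, Finset.prod_empty]
    nlinarith
  | succ n ih =>
    have e' : (scaleRatio κ K n ^ 2) ^ 2 = scaleRatio κ K n ^ 2 * scaleRatio κ K n ^ 2 := by ring
    rw [relScale_succ, scaleRatio_succ hK0, e']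
    gcongr

/-- The source of `η = κ / 24`: the threshold is the ratio to the power `κ / 6`, and four powers of
the ratio bound the next scale from below. -/
theorem concThreshold_le_relScale_rpow {κ K : ℝ} (hκ : 0 < κ) (hK1 : 1 ≤ K) (hK : 72 ^ κ ≤ K)
    (n : ℕ) : concThreshold K n ≤ relScale κ K (n + 1) ^ (κ / 24) := by
  have hK0 : 0 < K := by linarith
  have ht := concThreshold_pos hK0 n
  have h1 : concThreshold K n = (scaleRatio κ K n ^ 4) ^ (κ / 24) := by
    rw [scaleRatio, ← Real.rpow_natCast, ← Real.rpow_mul ht.le, ← Real.rpow_mul ht.le]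
    have : 6 / κ * ((4 : ℕ) : ℝ) * (κ / 24) = 1 := by
      push_cast
      field_simp
      norm_num
    rw [this, Real.rpow_one]
  rw [h1]
  have := scaleRatio_pos (κ := κ) hK0 n
  gcongr
  exact scaleRatio_pow_le_relScale hκ hK1 hK n

theorem exists_relScale_lt_le {κ K : ℝ} (hκ : 0 < κ) (hK1 : 1 ≤ K) (hK : 72 ^ κ ≤ K) {u : ℝ}
    (hu : 0 < u) (hu1 : u ≤ 1) : ∃ n, relScale κ K (n + 1) < u ∧ u ≤ relScale κ K n := by
  classical
  have hex : ∃ n, relScale κ K n < u := by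
    obtain ⟨n, hn⟩ := exists_pow_lt_of_lt_one hu (by norm_num : (1 / 2 : ℝ) < 1)
    exact ⟨n, (relScale_le_pow hκ hK1 hK n).trans_lt hn⟩
  have h0 : Nat.find hex ≠ 0 := by
    intro h
    have := Nat.find_spec hex
    rw [h] at this
    simp only [relScale, Finset.range_zero, Finset.prod_empty] at this
    linarith
  obtain ⟨n, hn⟩ := Nat.exists_eq_succ_of_ne_zero h0
  refine ⟨n, ?_, ?_⟩
  · have := Nat.find_spec hex
    rwa [hn] at this
  · exact not_lt.1 (Nat.find_min hex (by omega))

/-! ### Total mass and assembly of the theorem. -/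

theorem HasPlateDecay.mono {d j : ℕ} {μ : Measure (EuclideanSpace ℝ (Fin d))} {κ C C' : ℝ}
    (h : HasPlateDecay μ j κ C) (hC : C ≤ C') : HasPlateDecay μ j κ C' := fun r hr H hH =>
  (h r hr H hH).trans (ENNReal.ofReal_le_ofReal (by gcongr))

/-- The `2`-plate around any plane through the origin contains the unit ball, so decay alone bounds
the total mass. -/
theorem HasPlateDecay.measureReal_univ_le {d j : ℕ} (hj : j ≤ d)
    {μ : Measure (EuclideanSpace ℝ (Fin d))} {κ C : ℝ} (hC : 0 ≤ C) (h : HasPlateDecay μ j κ C)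
    (hμ : μ (Metric.closedBall 0 1)ᶜ = 0) : μ.real Set.univ ≤ C * 2 ^ κ := by
  obtain ⟨V, hV, h0⟩ := exists_isAffinePlane_zero_mem hj
  refine ENNReal.toReal_le_of_le_ofReal (by positivity) ?_
  rw [← Set.univ_inter Set.univ, ← measure_inter_conull (s := Set.univ ∩ Set.univ) hμ]
  refine (measure_mono ?_).trans (h 2 (by norm_num) _ (hV.isPlate 2))
  rintro x ⟨-, hx⟩
  refine Metric.mem_thickening_iff.2 ⟨0, h0, ?_⟩
  linarith [Metric.mem_closedBall.1 hx]

theorem mainTheorem11 (d k : ℕ) (hk : 1 ≤ k) (hkd : k < d) (κ : ℝ) (hκ : 0 < κ) :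
    ∃ η : ℝ, 0 < η ∧ ∀ Cμ Cν : ℝ, ∃ K₀ : ℝ, 0 < K₀ ∧
      ∀ r₀ : ℝ, 0 < r₀ → r₀ ≤ 1 → ∀ K : ℝ, K₀ ≤ K →
      ∀ (μ ν : Measure (EuclideanSpace ℝ (Fin d))) [IsFiniteMeasure μ] [IsFiniteMeasure ν]
        (X Y : Set (EuclideanSpace ℝ (Fin d))),
        X ⊆ Metric.closedBall 0 1 → Y ⊆ Metric.closedBall 0 1 →
        μ Xᶜ = 0 → ν Yᶜ = 0 →
        HasPlateDecay μ (k - 1) κ Cμ → HasPlateDecay ν (k - 1) κ Cν →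
        ∃ B : Set (EuclideanSpace ℝ (Fin d) × EuclideanSpace ℝ (Fin d)),
          MeasurableSet B ∧
          (μ.prod ν) B ≤ ENNReal.ofReal (K₀ * K⁻¹) ∧
          ∀ r₁ : ℝ, HasThinPlates ν k η (K * r₀ ^ (-η))
            (concentratedPairs ν X Y K⁻¹ r₀ k ∪ B)ᶜ r₁ := by
  refine ⟨κ / 24, by positivity, fun Cμ Cν => ?_⟩
  set C := max 1 (max Cμ Cν) with hCdef
  have hC1 : 1 ≤ C := le_max_left _ _
  have hCμ : Cμ ≤ C := (le_max_left _ _).trans (le_max_right _ _)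
  have hCν : Cν ≤ C := (le_max_right _ _).trans (le_max_right _ _)
  set m := C * 2 ^ κ with hmdef
  have h2κ : (1 : ℝ) ≤ 2 ^ κ := Real.one_le_rpow (by norm_num) hκ.le
  have h72κ : (1 : ℝ) ≤ 72 ^ κ := Real.one_le_rpow (by norm_num) hκ.le
  have hm : 1 ≤ m := one_le_mul_of_one_le_of_one_le hC1 h2κ
  have hm3 : 1 ≤ m ^ 3 := one_le_pow₀ hm
  have hmm3 : m ≤ m ^ 3 := le_self_pow₀ hm (by norm_num)
  -- This gives the smallness hypothesis of each step, and also dominates `72 ^ κ`, the mass `m` and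
  -- the series constant `2 * (1 + m)`.
  set K₀ := 9 * m ^ 3 * (C * 72 ^ κ) with hK₀def
  have hC72 : 1 ≤ C * 72 ^ κ := one_le_mul_of_one_le_of_one_le hC1 h72κ
  have hK₀9 : 9 * m ^ 3 ≤ K₀ := le_mul_of_one_le_right (by positivity) hC72
  have hK₀72 : 72 ^ κ ≤ K₀ := by
    calc (72 : ℝ) ^ κ ≤ C * 72 ^ κ := le_mul_of_one_le_left (by positivity) hC1
      _ ≤ K₀ := le_mul_of_one_le_left (by positivity) (by linarith)
  refine ⟨K₀, by positivity, ?_⟩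
  intro r₀ hr₀ hr₀1 K hK μ ν _ _ X Y hX hY hμX hνY hμ hν
  have hμB : μ (Metric.closedBall 0 1)ᶜ = 0 :=
    measure_mono_null (Set.compl_subset_compl.2 hX) hμX
  have hνB : ν (Metric.closedBall 0 1)ᶜ = 0 :=
    measure_mono_null (Set.compl_subset_compl.2 hY) hνY
  replace hμ := hμ.mono hCμ
  replace hν := hν.mono hCν
  have hμm := hμ.measureReal_univ_le (by omega) (by linarith) hμB
  have hνm := hν.measureReal_univ_le (by omega) (by linarith) hνB
  have hK2 : 2 ≤ K := by linarith
  have hK1 : 1 ≤ K := by linarith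
  have hK0 : 0 < K := by linarith
  have hK72 : 72 ^ κ ≤ K := hK₀72.trans hK
  have hKinv : K⁻¹ ≤ 1 := inv_le_one_of_one_le₀ hK1
  have step (n : ℕ) := exists_exceptional_set (k := k) hkd.le hκ (by linarith : 0 ≤ C) hm
    (concThreshold_pos hK0 n) ((concThreshold_le hK1 n).trans hKinv)
    (mul_pos (relScale_pos (κ := κ) hK0 n) hr₀)
    (mul_le_one₀ ((relScale_le_pow hκ hK1 hK72 n).trans (pow_le_one₀ (by norm_num) (by norm_num)))
      hr₀.le hr₀1)
    (scaleRatio_pos hK0 n) (scaleRatio_le hκ hK1 hK72 n)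
    (by
      have ht := concThreshold_pos hK0 n
      have h1 : K₀ * concThreshold K n ≤ 1 := by
        calc K₀ * concThreshold K n ≤ K * K⁻¹ := by gcongr; exact concThreshold_le hK1 n
          _ = 1 := mul_inv_cancel₀ hK0.ne'
      rw [Real.mul_rpow (by norm_num) (scaleRatio_pos hK0 n).le, scaleRatio_rpow hκ hK0]
      calc 9 * m ^ 3 * (C * (72 ^ κ * concThreshold K n ^ 6))
          = (K₀ * concThreshold K n) * concThreshold K n ^ 5 := by rw [hK₀def]; ring
        _ ≤ 1 * concThreshold K n ^ 5 := by gcongr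
        _ = _ := one_mul _)
    μ ν hμm hνm hνB hμ hν
  choose D hDm hDμ hD using step
  -- `X` and `Y` need not be measurable; null hulls of their complements absorb the pairs outside `X
  -- × Y`, which `A` cannot contain.
  let NX := toMeasurable μ Xᶜ
  let NY := toMeasurable ν Yᶜ
  refine ⟨(NX ×ˢ Set.univ ∪ Set.univ ×ˢ NY) ∪ ⋃ n, D n,
    (((measurableSet_toMeasurable _ _).prod MeasurableSet.univ).union
      (MeasurableSet.univ.prod (measurableSet_toMeasurable _ _))).union
      (MeasurableSet.iUnion hDm), ?_, ?_⟩
  · have hnull : (μ.prod ν) (NX ×ˢ Set.univ ∪ Set.univ ×ˢ NY) = 0 := by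
      rw [measure_union_null_iff, Measure.prod_prod, Measure.prod_prod, measure_toMeasurable,
        measure_toMeasurable, hμX, hνY]
      simp
    have hsum : HasSum (fun n : ℕ => (1 + m) * (K⁻¹ * (1 / 2) ^ n)) ((1 + m) * (K⁻¹ * 2)) :=
      (hasSum_geometric_two.mul_left _).mul_left _
    calc (μ.prod ν) ((NX ×ˢ Set.univ ∪ Set.univ ×ˢ NY) ∪ ⋃ n, D n)
        ≤ (μ.prod ν) (NX ×ˢ Set.univ ∪ Set.univ ×ˢ NY) + (μ.prod ν) (⋃ n, D n) :=
          measure_union_le _ _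
      _ = (μ.prod ν) (⋃ n, D n) := by rw [hnull, zero_add]
      _ ≤ ∑' n, (μ.prod ν) (D n) := measure_iUnion_le _
      _ ≤ ∑' n, ENNReal.ofReal ((1 + m) * (K⁻¹ * (1 / 2) ^ n)) := by
          refine ENNReal.tsum_le_tsum fun n => (hDμ n).trans (ENNReal.ofReal_le_ofReal ?_)
          gcongr
          exact concThreshold_le_geometric hK2 n
      _ = ENNReal.ofReal ((1 + m) * (K⁻¹ * 2)) := by
          rw [← ENNReal.ofReal_tsum_of_nonneg (fun n => by positivity) hsum.summable, hsum.tsum_eq]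
      _ ≤ ENNReal.ofReal (K₀ * K⁻¹) := by
          refine ENNReal.ofReal_le_ofReal ?_
          have : (1 + m) * (K⁻¹ * 2) = (2 * (1 + m)) * K⁻¹ := by ring
          rw [this]
          gcongr
          linarith
  · intro r₁ x r hr _ H hH hxH
    obtain ⟨V, hVne, hVk, rfl⟩ := hH
    have hV : IsAffinePlane k V := ⟨hVne, hVk⟩
    have hrhs : K * r₀ ^ (-(κ / 24)) * r ^ (κ / 24) = K * (r / r₀) ^ (κ / 24) := by
      rw [Real.div_rpow hr.le hr₀.le, Real.rpow_neg hr₀.le]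
      ring
    rw [hrhs]
    rcases le_total r₀ r with hrr | hrr
    -- Above scale `r₀` the total mass bound `m ≤ K₀ ≤ K` suffices.
    · have h1 : K ≤ K * (r / r₀) ^ (κ / 24) :=
        le_mul_of_one_le_right hK0.le
          (Real.one_le_rpow ((one_le_div hr₀).2 hrr) (by positivity))
      refine (measure_mono (Set.subset_univ _)).trans
        ((ENNReal.le_ofReal_iff_toReal_le (measure_ne_top _ _) (by linarith)).2
          (hνm.trans ?_))
      linarith
    · obtain ⟨n, hn1, hn2⟩ := exists_relScale_lt_le hκ hK1 hK72 (div_pos hr hr₀)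
        ((div_le_one hr₀).2 hrr)
      rw [div_le_iff₀ hr₀] at hn2
      have hmem : ∀ j : ℕ, ∀ W : AffineSubspace ℝ (EuclideanSpace ℝ (Fin d)), IsAffinePlane k W →
          ENNReal.ofReal (concThreshold K j) ≤ ν (Metric.thickening (relScale κ K j * r₀)
            (W : Set (EuclideanSpace ℝ (Fin d)))) →
          ∀ x ∈ X, ∀ y ∈ Y,
            x ∈ Metric.thickening (relScale κ K j * r₀) (W : Set (EuclideanSpace ℝ (Fin d))) →
            y ∈ Metric.thickening (relScale κ K j * r₀) (W : Set (EuclideanSpace ℝ (Fin d))) →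
            (x, y) ∈ concentratedPairs ν X Y K⁻¹ r₀ k ∪ ⋃ n, D n := by
        intro j
        induction j with
        | zero =>
          intro W hW hWν x hx y hy hxW hyW
          simp only [relScale, Finset.range_zero, Finset.prod_empty, one_mul, concThreshold,
            pow_zero, pow_one] at hWν hxW hyW
          exact Or.inl ⟨hx, hy, _, hW.isPlate r₀, hWν, hxW, hyW⟩
        | succ j ih =>
          intro W hW hWν x hx y hy hxW hyW
          have e : relScale κ K (j + 1) * r₀ = relScale κ K j * r₀ * scaleRatio κ K j ^ 2 := by
            rw [relScale_succ]
            ring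
          rw [e] at hWν hxW hyW
          rw [concThreshold_succ] at hWν
          rcases hD j W hW hWν x (hX hx) y (hY hy) hxW hyW with h | ⟨W', hW', hxW', hyW', hW'ν⟩
          · exact Or.inr (Set.mem_iUnion.2 ⟨j, h⟩)
          · exact ih W' hW' hW'ν x hx y hy hxW' hyW'
      have hsub := Metric.thickening_mono hn2 (V : Set (EuclideanSpace ℝ (Fin d)))
      by_cases hheavy : ENNReal.ofReal (concThreshold K n) ≤
          ν (Metric.thickening (relScale κ K n * r₀) (V : Set (EuclideanSpace ℝ (Fin d))))
      · have hempty : Metric.thickening r (V : Set (EuclideanSpace ℝ (Fin d))) ∩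
            {y | (x, y) ∈ (concentratedPairs ν X Y K⁻¹ r₀ k ∪
              ((NX ×ˢ Set.univ ∪ Set.univ ×ˢ NY) ∪ ⋃ n, D n))ᶜ} = ∅ := by
          rw [Set.eq_empty_iff_forall_notMem]
          rintro y ⟨hyV, hy⟩
          apply hy
          by_cases hx : x ∈ X
          · by_cases hy' : y ∈ Y
            · rcases hmem n V hV hheavy x hx y hy' (hsub hxH) (hsub hyV) with h | h
              · exact Or.inl h
              · exact Or.inr (Or.inr h)
            · exact Or.inr (Or.inl (Or.inr ⟨Set.mem_univ _, subset_toMeasurable _ _ hy'⟩))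
          · exact Or.inr (Or.inl (Or.inl ⟨subset_toMeasurable _ _ hx, Set.mem_univ _⟩))
        rw [hempty, measure_empty]
        exact zero_le
      · refine (measure_mono (Set.inter_subset_left.trans hsub)).trans
          ((not_le.1 hheavy).le.trans (ENNReal.ofReal_le_ofReal ?_))
        have hs := relScale_pos (κ := κ) hK0 (n + 1)
        calc concThreshold K n ≤ relScale κ K (n + 1) ^ (κ / 24) :=
              concThreshold_le_relScale_rpow hκ hK1 hK72 n
          _ ≤ (r / r₀) ^ (κ / 24) := by gcongr
          _ ≤ K * (r / r₀) ^ (κ / 24) := le_mul_of_one_le_left (by positivity) hK1
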